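/- For finite subsets $X,Y$ of an abelian group let $\mathsf{E}(X,Y)=|\{(x,x',y,y')\in X\times X\times Y\times Y : x-y=x'-y'\}|$, and for a finite non-empty set $A$ let $$\mathcal{E}_*[A]=\max_{X\sqcup Y=A}\frac{|X|^2|Y|^2}{|A|\,\mathsf{E}(X,Y)},$$ the maximum being over all partitions of $A$ into two disjoint sets $X,Y$ (a partition with an empty part contributes $0$). There is an absolute constant $C>0$ such that for every abelian group $\mathbf{G}$ and every finite non-empty set $A\subseteq\mathbf{G}$ the following hold. 1. With $M=\mathcal{E}_*[A]$, $$\frac{|A+A|}{|A|}\leqslant \exp\left(C\,M^{1/3}\log^2(\max\{M,2\})\right).$$ 2. If $K>0$ is a real number such that $\mathsf{E}(X,Y)\geqslant \frac{|X|^2|Y|^2}{K|A|}$ for all disjoint $X,Y$ with $X\cup Y=A$, then $$\frac{|A+A|}{|A|}\leqslant \exp\left(C\,K^{1/3}\log^2(\max\{K,2\})\right).$$ -/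

import Mathlib

open scoped Pointwise

/-- The quantity `E_*[A]`: the maximum of `|X|² |Y|² / (|A| E(X, Y))` over all ways of writing `A`
as a disjoint union of `X` and `Y`, that is, over all `X ⊆ A` with `Y = A \ X`. Here `E(X, Y)` is
Mathlib's additive energy, the number of `(x, x', y, y')` in `X × X × Y × Y` with
`x + y = x' + y'` (equivalently, swapping `y` and `y'`, with `x - y = x' - y'`). If both parts are non-empty then `E(X, Y) > 0`; the two partitions with an
empty part give `0 / 0 = 0`, so they do not affect the maximum when `A` has at least two
elements. -/
noncomputable def energyStar {G : Type*} [AddCommGroup G] [DecidableEq G] (A : Finset G) : ℝ :=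
  A.powerset.sup' (Finset.powerset_nonempty A) fun X =>
    ((X.card : ℝ) ^ 2 * ((A \ X).card : ℝ) ^ 2) / ((A.card : ℝ) * (X.addEnergy (A \ X) : ℝ))

/-- The doubling constant `|A + A| / |A|`. -/
noncomputable def doublingConstant {G : Type*} [AddCommGroup G] [DecidableEq G]
    (A : Finset G) : ℝ :=
  ((A + A).card : ℝ) / (A.card : ℝ)

/-! Put `L = max K 2` and `n = |A|`. A balanced cut gives `A` energy at least `n³/(21L)`, so
Balog–Szemerédi–Gowers yields `X₀ ⊆ A` of density at least `1/(168L)` and doubling polynomial in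
`L`. Then `X₀` is thickened inside `A`: each step adds the points of `A` in polynomially many (in
`L`) translates of the current set, chosen so that the set has little energy with what is left out.
For consecutive sets `U ⊆ X ⊆ V`, the energy of the cut at `X` must therefore come from `X \ U`
against `V \ X`, and it is at most `(|V| - |U|)³`. Large cut energy thus forces `|V| - |U|` to be of
order at least `L^(-1/3) min(|X|, n - |X|)`: the odds `|X|/(n - |X|)` gain a factor `1 + β`, `β ≍
L^(-1/3)`, every two steps. After `O(L^(1/3) log L)` steps all but `n/(16L)` points are reached, at
a cost of `exp(O(L^(1/3) log² L))` translates of `X₀`; one logarithm counts steps, the other is the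
price of a step. A maximal separated set in the remainder has `O(L)` points, so few translates of `X
- X` cover `A`, and Plünnecke–Ruzsa for `X₀` finishes. The main lemmas are
`HasLargeCutEnergy.sq_mul_sq_le_cube`, `one_add_mul_mul_sub_le` and
`HasLargeCutEnergy.exists_covering`. -/

/-! ### Energy bounds and greedy covering -/

open Finset in
/-- If every translate of `X` meets `Y` in at most `τ` points, then the energy of `X` and `Y` is at
most `τ |X| |Y|`. -/
theorem addEnergy_le_of_card_translate_le {G : Type*} [AddCommGroup G] [DecidableEq G]
    {X Y : Finset G} {τ : ℝ} (h : ∀ s, ((Y.filter fun y => y - s ∈ X).card : ℝ) ≤ τ) :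
    (X.addEnergy Y : ℝ) ≤ τ * X.card * Y.card := by
  -- A quadruple is determined by `x`, `y'` and `y`, and `x' = y - (y' - x)` puts `y` in a translate
  -- of `X`.
  have h1 : X.addEnergy Y ≤ ∑ p ∈ X ×ˢ Y, (Y.filter fun y => y - (p.2 - p.1) ∈ X).card := by
    rw [← Finset.card_sigma, Finset.addEnergy]
    refine Finset.card_le_card_of_injOn
      (fun q => (⟨(q.1.1, q.2.2), q.2.1⟩ : Σ _ : G × G, G)) ?_ ?_
    · rintro ⟨⟨x, x'⟩, y, y'⟩ hq
      simp only [mem_coe, mem_filter, mem_product] at hq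
      obtain ⟨⟨⟨hx, hx'⟩, hy, hy'⟩, he⟩ := hq
      simp only [coe_sigma, Set.mem_sigma_iff, mem_coe, mem_product, mem_filter]
      refine ⟨⟨hx, hy'⟩, hy, ?_⟩
      have : y - (y' - x) = x' := by
        rw [sub_sub_eq_add_sub, add_comm y x, he]; abel
      rwa [this]
    · rintro ⟨⟨x, x'⟩, y, y'⟩ hq ⟨⟨z, z'⟩, w, w'⟩ hq' he
      simp only [mem_coe, mem_filter] at hq hq'
      simp only [Sigma.mk.injEq, Prod.mk.injEq, heq_eq_eq] at he
      obtain ⟨⟨rfl, rfl⟩, rfl⟩ := he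
      have h3 : x' + y' = z' + y' := by rw [← hq.2, ← hq'.2]
      simpa using h3
  calc (X.addEnergy Y : ℝ)
      ≤ ∑ p ∈ X ×ˢ Y, ((Y.filter fun y => y - (p.2 - p.1) ∈ X).card : ℝ) := by exact_mod_cast h1
    _ ≤ ∑ _p ∈ X ×ˢ Y, τ := Finset.sum_le_sum fun p _ => h _
    _ = τ * X.card * Y.card := by
        rw [Finset.sum_const, Finset.card_product, nsmul_eq_mul]; push_cast; ring

/-- The trivial upper bound for the energy. -/
theorem addEnergy_le_sq_card_mul_card {G : Type*} [AddCommGroup G] [DecidableEq G]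
    (X Y : Finset G) : (X.addEnergy Y : ℝ) ≤ (X.card : ℝ) ^ 2 * Y.card := by
  have h := addEnergy_le_of_card_translate_le (X := X) (Y := Y) (τ := X.card) fun s => by
    refine Nat.cast_le.2 (Finset.card_le_card_of_injOn (fun y => y - s) ?_ ?_)
    · intro y hy
      exact (Finset.mem_filter.1 hy).2
    · intro y _ z _ he
      simpa using he
  calc _ ≤ _ := h
    _ = _ := by ring

theorem addEnergy_le_card_mul_sq_card {G : Type*} [AddCommGroup G] [DecidableEq G]
    (X Y : Finset G) : (X.addEnergy Y : ℝ) ≤ X.card * (Y.card : ℝ) ^ 2 := by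
  have h := addEnergy_le_sq_card_mul_card Y X
  rw [Finset.addEnergy_comm] at h
  linarith

open Finset in
theorem addEnergy_eq_sum_sq_of_subset {G : Type*} [AddCommGroup G] [DecidableEq G]
    {X Y D : Finset G} (hD : X + Y ⊆ D) :
    X.addEnergy Y = ∑ a ∈ D, ((X ×ˢ Y).filter fun q => q.1 + q.2 = a).card ^ 2 := by
  rw [Finset.addEnergy_eq_sum_sq']
  refine Finset.sum_subset hD fun a _ ha => ?_
  rw [Finset.card_eq_zero.2, zero_pow two_ne_zero]
  refine Finset.filter_eq_empty_iff.2 fun q hq he => ha ?_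
  rw [← he]
  exact Finset.add_mem_add (Finset.mem_product.1 hq).1 (Finset.mem_product.1 hq).2

/-- Quasi-additivity of the energy in its first argument. -/
theorem addEnergy_union_left_le {G : Type*} [AddCommGroup G] [DecidableEq G]
    (U V Y : Finset G) :
    (U ∪ V).addEnergy Y ≤ 2 * U.addEnergy Y + 2 * V.addEnergy Y := by
  have hU : U + Y ⊆ (U ∪ V) + Y := Finset.add_subset_add_right Finset.subset_union_left
  have hV : V + Y ⊆ (U ∪ V) + Y := Finset.add_subset_add_right Finset.subset_union_right
  rw [addEnergy_eq_sum_sq_of_subset hU, addEnergy_eq_sum_sq_of_subset hV,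
    addEnergy_eq_sum_sq_of_subset subset_rfl, Finset.mul_sum, Finset.mul_sum,
    ← Finset.sum_add_distrib]
  refine Finset.sum_le_sum fun a _ => ?_
  rw [Finset.union_product, Finset.filter_union]
  have h := Finset.card_union_le ((U ×ˢ Y).filter fun q => q.1 + q.2 = a)
    ((V ×ˢ Y).filter fun q => q.1 + q.2 = a)
  calc _ ≤ _ := Nat.pow_le_pow_left h 2
    _ ≤ _ := by
      zify
      linarith [add_sq_le (a := (((U ×ˢ Y).filter fun q => q.1 + q.2 = a).card : ℤ))
        (b := (((V ×ˢ Y).filter fun q => q.1 + q.2 = a).card : ℤ))]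

theorem addEnergy_union_right_le {G : Type*} [AddCommGroup G] [DecidableEq G]
    (X U V : Finset G) :
    X.addEnergy (U ∪ V) ≤ 2 * X.addEnergy U + 2 * X.addEnergy V := by
  rw [Finset.addEnergy_comm X, Finset.addEnergy_comm X, Finset.addEnergy_comm X]
  exact addEnergy_union_left_le U V X

/-- Greedy covering: after removing from `Y` few translates of `X`, no translate of `X` meets the
rest of `Y` in more than `τ` points. -/
theorem exists_card_translate_inter_sdiff_le {G : Type*} [AddCommGroup G] [DecidableEq G]
    (X Y : Finset G) {τ : ℝ} (hτ : 0 < τ) :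
    ∃ S : Finset G, (S.card : ℝ) * τ ≤ Y.card ∧
      ∀ s, (((Y \ (X + S)).filter fun y => y - s ∈ X).card : ℝ) ≤ τ := by
  induction Y using Finset.strongInduction with
  | H Y ih =>
    by_cases h : ∀ s, ((Y.filter fun y => y - s ∈ X).card : ℝ) ≤ τ
    · exact ⟨∅, by simp, by simpa using h⟩
    -- A rich translate is removed; it takes more than `τ` points of `Y`, which pays for the new
    -- element of `S`.
    · push Not at h
      obtain ⟨s, hs⟩ := h
      have hcard := Finset.card_filter_add_card_filter_not (s := Y) (fun y => y - s ∈ X)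
      have hpos : 0 < (Y.filter fun y => y - s ∈ X).card := by
        have : (0 : ℝ) < (Y.filter fun y => y - s ∈ X).card := hτ.trans hs
        exact_mod_cast this
      have hss : Y.filter (fun y => ¬ y - s ∈ X) ⊂ Y := by
        refine Finset.ssubset_iff_subset_ne.2 ⟨Finset.filter_subset _ _, fun he => ?_⟩
        rw [he] at hcard
        omega
      obtain ⟨S, hS, hS'⟩ := ih _ hss
      refine ⟨insert s S, ?_, fun t => le_trans (Nat.cast_le.2 (Finset.card_le_card ?_)) (hS' t)⟩
      · have h1 : ((insert s S).card : ℝ) ≤ S.card + 1 := by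
          exact_mod_cast Finset.card_insert_le s S
        have h2 : ((Y.filter fun y => y - s ∈ X).card : ℝ)
            + (Y.filter fun y => ¬ y - s ∈ X).card = Y.card := by exact_mod_cast hcard
        nlinarith
      · refine Finset.filter_subset_filter _ fun y hy => ?_
        rw [Finset.mem_sdiff] at hy ⊢
        refine ⟨Finset.mem_filter.2 ⟨hy.1, fun hys => hy.2 ?_⟩, fun hyS => hy.2 ?_⟩
        · exact Finset.mem_add.2 ⟨y - s, hys, s, Finset.mem_insert_self _ _, sub_add_cancel _ _⟩
        · exact Finset.add_subset_add_left (Finset.subset_insert _ _) hyS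

/-! ### Balog–Szemerédi–Gowers -/

open Finset in
open scoped Classical in
/-- Dependent random choice: in a dense graph there is a large set of vertices any two of which are
joined by many paths of length four. -/
theorem exists_subset_many_paths {α : Type*} (A : Finset α) (R : α → α → Prop) {δ : ℝ}
    (hδ : 0 < δ) (hA : A.Nonempty)
    (hR : δ * (A.card : ℝ) ^ 2 ≤ ((A ×ˢ A).filter fun p => R p.1 p.2).card) :
    ∃ A' ⊆ A, δ * A.card / 4 ≤ A'.card ∧ ∀ a ∈ A', ∀ a' ∈ A',
      δ ^ 5 * (A.card : ℝ) ^ 3 / 2 ^ 10 ≤ ((A ×ˢ A ×ˢ A).filter fun t =>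
        R a t.2.1 ∧ R t.1 t.2.1 ∧ R t.1 t.2.2 ∧ R a' t.2.2).card := by
  set n : ℝ := (A.card : ℝ) with hn
  have hn0 : 0 < n := by rw [hn]; exact_mod_cast hA.card_pos
  let N : α → Finset α := fun v => A.filter fun a => R a v
  let cn : α → α → Finset α := fun a b => A.filter fun c => R a c ∧ R b c
  let bad : α → α → Prop := fun a b => ((cn a b).card : ℝ) ≤ δ ^ 2 / 16 * n
  let Bd : α → Finset (α × α) := fun v => (N v ×ˢ N v).filter fun p => bad p.1 p.2
  have hN : δ * n ^ 2 ≤ ∑ v ∈ A, ((N v).card : ℝ) := by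
    refine hR.trans (le_of_eq ?_)
    rw [Finset.card_filter, Finset.sum_product_right]
    simp only [N, Finset.card_filter]
    push_cast
    rfl
  have hN2 : δ ^ 2 * n ^ 3 ≤ ∑ v ∈ A, ((N v).card : ℝ) ^ 2 := by
    have h1 := sq_sum_le_card_mul_sum_sq (s := A) (f := fun v => ((N v).card : ℝ))
    have h2 : (δ * n ^ 2) ^ 2 ≤ (∑ v ∈ A, ((N v).card : ℝ)) ^ 2 :=
      pow_le_pow_left₀ (by positivity) hN 2
    have h3 : n * (δ ^ 2 * n ^ 3) ≤ n * ∑ v ∈ A, ((N v).card : ℝ) ^ 2 := by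
      calc _ = (δ * n ^ 2) ^ 2 := by ring
        _ ≤ _ := h2.trans h1
    exact le_of_mul_le_mul_left h3 hn0
  have hBd : ∑ v ∈ A, ((Bd v).card : ℝ) ≤ δ ^ 2 / 16 * n ^ 3 := by
    have h1 : ∀ v ∈ A, ((Bd v).card : ℝ) =
        ∑ p ∈ (A ×ˢ A).filter (fun p => bad p.1 p.2), if R p.1 v ∧ R p.2 v then (1 : ℝ) else 0 := by
      intro v _
      rw [← Finset.sum_filter, Finset.sum_const, nsmul_eq_mul, mul_one]
      congr 2
      ext p
      simp only [Bd, N, mem_filter, mem_product]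
      tauto
    rw [Finset.sum_congr rfl h1, Finset.sum_comm]
    calc _ ≤ ∑ p ∈ (A ×ˢ A).filter (fun p => bad p.1 p.2), δ ^ 2 / 16 * n := by
          refine Finset.sum_le_sum fun p hp => ?_
          rw [← Finset.sum_filter, Finset.sum_const, nsmul_eq_mul, mul_one]
          exact (Finset.mem_filter.1 hp).2
      _ ≤ ∑ p ∈ A ×ˢ A, δ ^ 2 / 16 * n :=
          Finset.sum_le_sum_of_subset_of_nonneg (Finset.filter_subset _ _)
            fun _ _ _ => by positivity
      _ = δ ^ 2 / 16 * n ^ 3 := by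
          rw [Finset.sum_const, Finset.card_product, nsmul_eq_mul]
          push_cast
          rw [← hn]
          ring
  -- With weight 8 the bad pairs cost at most half of the second moment. They then number at most
  -- `|N v|²/8`, so at most half of `N v` has over `|N v|/4` bad partners.
  obtain ⟨v, hvA, hv⟩ : ∃ v ∈ A, δ ^ 2 * n ^ 2 / 2 ≤ ((N v).card : ℝ) ^ 2 - 8 * (Bd v).card := by
    refine Finset.exists_le_of_sum_le hA ?_
    rw [Finset.sum_sub_distrib, ← Finset.mul_sum, Finset.sum_const, nsmul_eq_mul, ← hn]
    nlinarith
  have hNv : δ * n / 2 ≤ (N v).card := by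
    refine le_of_sq_le_sq ?_ (Nat.cast_nonneg _)
    have : (0 : ℝ) ≤ (Bd v).card := Nat.cast_nonneg _
    have h2 : 0 ≤ δ ^ 2 * n ^ 2 := by positivity
    nlinarith
  have hNv0 : (0 : ℝ) < (N v).card := lt_of_lt_of_le (by positivity) hNv
  let bads : α → Finset α := fun a => (N v).filter fun b => bad a b
  let A' := (N v).filter fun a => ((bads a).card : ℝ) ≤ (N v).card / 4
  have hsplit : ((A'.card : ℝ)) +
      ((N v).filter fun a => ¬ ((bads a).card : ℝ) ≤ (N v).card / 4).card = (N v).card := by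
    exact_mod_cast Finset.card_filter_add_card_filter_not (s := N v)
      (fun a => ((bads a).card : ℝ) ≤ (N v).card / 4)
  have hBsum : ((Bd v).card : ℝ) = ∑ a ∈ N v, ((bads a).card : ℝ) := by
    simp only [Bd, bads]
    rw [Finset.card_filter, Finset.sum_product]
    simp only [Finset.card_filter]
    push_cast
    rfl
  have hlow : (((N v).filter fun a => ¬ ((bads a).card : ℝ) ≤ (N v).card / 4).card : ℝ)
      * ((N v).card / 4) ≤ (Bd v).card := by
    rw [hBsum, ← nsmul_eq_mul, ← Finset.sum_const]
    refine le_trans (Finset.sum_le_sum fun a ha => ?_)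
      (Finset.sum_le_sum_of_subset_of_nonneg (Finset.filter_subset _ _)
        fun _ _ _ => Nat.cast_nonneg _)
    exact (not_le.1 (Finset.mem_filter.1 ha).2).le
  have hA'card : δ * n / 4 ≤ A'.card := by
    have h2 : 0 ≤ δ ^ 2 * n ^ 2 := by positivity
    have h3 : (((N v).filter fun a => ¬ ((bads a).card : ℝ) ≤ (N v).card / 4).card : ℝ)
        ≤ (N v).card / 2 := by
      refine le_of_mul_le_mul_right ?_ (show (0 : ℝ) < (N v).card / 4 by positivity)
      nlinarith
    linarith
  refine ⟨A', (Finset.filter_subset _ _).trans (Finset.filter_subset _ _), hA'card, ?_⟩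
  intro a ha a' ha'
  have hab := (Finset.mem_filter.1 ha).2
  have hab' := (Finset.mem_filter.1 ha').2
  -- Midpoints `b` of paths `a, c, b, c', a'`: at least half of `N v` is good for both ends.
  let good := (N v).filter fun b => ¬ bad a b ∧ ¬ bad a' b
  have hgood : δ * n / 4 ≤ good.card := by
    have h1 : N v ⊆ good ∪ (bads a ∪ bads a') := by
      intro b hb
      simp only [good, bads, mem_union, mem_filter]
      tauto
    have h2 : ((N v).card : ℝ) ≤ good.card + ((bads a).card + (bads a').card) := by
      exact_mod_cast (Finset.card_le_card h1).trans ((Finset.card_union_le _ _).trans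
        (Nat.add_le_add_left (Finset.card_union_le _ _) _))
    linarith
  have hsub : (good.sigma fun b => cn a b ×ˢ cn a' b).card ≤ ((A ×ˢ A ×ˢ A).filter fun t =>
        R a t.2.1 ∧ R t.1 t.2.1 ∧ R t.1 t.2.2 ∧ R a' t.2.2).card := by
    refine Finset.card_le_card_of_injOn (fun s => (s.1, s.2.1, s.2.2)) ?_ ?_
    · rintro ⟨b, c, c'⟩ hb
      simp only [mem_coe, mem_sigma, mem_product, good, N, cn, mem_filter] at hb ⊢
      tauto
    · rintro ⟨b, c, c'⟩ _ ⟨d, e, e'⟩ _ h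
      simp only [Prod.mk.injEq] at h
      obtain ⟨rfl, rfl, rfl⟩ := h
      rfl
  calc δ ^ 5 * n ^ 3 / 2 ^ 10 = (δ * n / 4) * (δ ^ 2 / 16 * n) ^ 2 := by ring
    _ ≤ good.card * (δ ^ 2 / 16 * n) ^ 2 := by gcongr
    _ = ∑ _b ∈ good, (δ ^ 2 / 16 * n) * (δ ^ 2 / 16 * n) := by
        rw [Finset.sum_const, nsmul_eq_mul, sq]
    _ ≤ ∑ b ∈ good, ((cn a b).card : ℝ) * (cn a' b).card := by
        refine Finset.sum_le_sum fun b hb => ?_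
        have := (Finset.mem_filter.1 hb).2
        exact mul_le_mul (not_le.1 this.1).le (not_le.1 this.2).le (by positivity)
          (Nat.cast_nonneg _)
    _ = ((good.sigma fun b => cn a b ×ˢ cn a' b).card : ℝ) := by
        rw [Finset.card_sigma]
        push_cast [Finset.card_product]
        rfl
    _ ≤ _ := by exact_mod_cast hsub

open Finset in
/-- The Balog–Szemerédi–Gowers theorem, for differences. -/
theorem exists_subset_card_sub_le_of_addEnergy {G : Type*} [AddCommGroup G] [DecidableEq G]
    {A : Finset G} {κ : ℝ} (hA : A.Nonempty) (hκ : 0 < κ)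
    (hE : (A.card : ℝ) ^ 3 / κ ≤ A.addEnergy A) :
    ∃ A' ⊆ A, A.card / (8 * κ) ≤ (A'.card : ℝ) ∧
      ((A' - A').card : ℝ) ≤ 2 ^ 19 * κ ^ 9 * A.card := by
  classical
  set n : ℝ := (A.card : ℝ) with hn
  have hn0 : 0 < n := by rw [hn]; exact_mod_cast hA.card_pos
  let r : G → Finset (G × G) := fun s => (A ×ˢ A).filter fun p => p.1 - p.2 = s
  -- Edges are pairs with a popular difference; unpopular pairs carry at most half of `n³/κ`, which
  -- gives density `1/(2κ)`.
  let R : G → G → Prop := fun a b => n / (2 * κ) ≤ (r (a - b)).card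
  have hEr : (A.addEnergy A : ℝ) ≤ ∑ p ∈ A ×ˢ A, ((r (p.1 - p.2)).card : ℝ) := by
    have : A.addEnergy A ≤ ∑ p ∈ A ×ˢ A, (r (p.1 - p.2)).card := by
      rw [← Finset.card_sigma, Finset.addEnergy]
      refine Finset.card_le_card_of_injOn
        (fun q => (⟨(q.1.1, q.1.2), (q.2.2, q.2.1)⟩ : Σ _ : G × G, G × G)) ?_ ?_
      · rintro ⟨⟨x, x'⟩, y, y'⟩ hq
        simp only [mem_coe, mem_filter, mem_product] at hq
        simp only [r, mem_coe, mem_sigma, mem_product, mem_filter]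
        refine ⟨hq.1.1, hq.1.2.symm, ?_⟩
        rw [sub_eq_sub_iff_add_eq_add, add_comm y' x', ← hq.2]
      · rintro ⟨⟨x, x'⟩, y, y'⟩ _ ⟨⟨z, z'⟩, w, w'⟩ _ he
        simp only [Sigma.mk.injEq, Prod.mk.injEq, heq_eq_eq] at he
        obtain ⟨⟨rfl, rfl⟩, rfl, rfl⟩ := he
        rfl
    exact_mod_cast this
  have hrle : ∀ s, ((r s).card : ℝ) ≤ n := by
    intro s
    refine Nat.cast_le.2 (Finset.card_le_card_of_injOn Prod.fst ?_ ?_)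
    · intro p hp
      exact (Finset.mem_product.1 (Finset.mem_filter.1 hp).1).1
    · rintro ⟨x, y⟩ hp ⟨z, w⟩ hq (rfl : x = z)
      have h1 := (Finset.mem_filter.1 hp).2
      have h2 := (Finset.mem_filter.1 hq).2
      simp only at h1 h2
      rw [← h2, sub_right_inj] at h1
      rw [h1]
  have hR : 1 / (2 * κ) * n ^ 2 ≤ ((A ×ˢ A).filter fun p => R p.1 p.2).card := by
    have h1 : (A.addEnergy A : ℝ) ≤ n * ((A ×ˢ A).filter fun p => R p.1 p.2).card
        + n ^ 2 * (n / (2 * κ)) := by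
      refine hEr.trans ?_
      calc _ ≤ ∑ p ∈ A ×ˢ A, ((if R p.1 p.2 then n else 0) + n / (2 * κ)) := by
            refine Finset.sum_le_sum fun p _ => ?_
            split_ifs with h
            · have := hrle (p.1 - p.2)
              have : 0 ≤ n / (2 * κ) := by positivity
              linarith
            · have := (not_le.1 h).le
              linarith
        _ = _ := by
            rw [Finset.sum_add_distrib, ← Finset.sum_filter, Finset.sum_const, Finset.sum_const,
              Finset.card_product, nsmul_eq_mul, nsmul_eq_mul]
            push_cast
            rw [← hn]
            ring
    have h2 : n * (1 / (2 * κ) * n ^ 2) ≤ n * ((A ×ˢ A).filter fun p => R p.1 p.2).card := by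
      have h3 : n ^ 3 / κ = n * (1 / (2 * κ) * n ^ 2) + n ^ 2 * (n / (2 * κ)) := by
        field_simp; ring
      linarith
    exact le_of_mul_le_mul_left h2 hn0
  obtain ⟨A', hA'A, hA'c, hA'p⟩ := exists_subset_many_paths A R (by positivity) hA hR
  refine ⟨A', hA'A, ?_, ?_⟩
  · refine le_trans (le_of_eq ?_) hA'c
    rw [← hn]
    field_simp
    norm_num
  let Q : Finset ((G × G) × (G × G) × (G × G) × (G × G)) :=
    (A ×ˢ A) ×ˢ (A ×ˢ A) ×ˢ (A ×ˢ A) ×ˢ (A ×ˢ A)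
  let dif : G × G → G := fun p => p.1 - p.2
  let f : (G × G) × (G × G) × (G × G) × (G × G) → G := fun q =>
    dif q.1 - dif q.2.1 + dif q.2.2.1 - dif q.2.2.2
  have hQ : (Q.card : ℝ) = n ^ 8 := by
    simp only [Q, Finset.card_product]
    push_cast
    rw [← hn]
    ring
  -- Along a path, `a - a' = (a - c) - (b - c) + (b - c') - (a' - c')`, with four popular
  -- differences. So each `d` has at least `n⁷/(2¹⁹κ⁹)` representations among `n⁸` octuples.
  have hfib : ∀ d ∈ A' - A', (1 / (2 * κ)) ^ 5 * n ^ 3 / 2 ^ 10 * (n / (2 * κ)) ^ 4 ≤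
      ((Q.filter fun q => f q = d).card : ℝ) := by
    intro d hd
    obtain ⟨a, ha, a', ha', rfl⟩ := Finset.mem_sub.1 hd
    set T := (A ×ˢ A ×ˢ A).filter fun t =>
        R a t.2.1 ∧ R t.1 t.2.1 ∧ R t.1 t.2.2 ∧ R a' t.2.2 with hT
    have hTc := hA'p a ha a' ha'
    rw [← hT, ← hn] at hTc
    have hsub : (T.sigma fun t => r (a - t.2.1) ×ˢ r (t.1 - t.2.1) ×ˢ r (t.1 - t.2.2) ×ˢ
        r (a' - t.2.2)).card ≤ (Q.filter fun q => f q = a - a').card := by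
      refine Finset.card_le_card_of_injOn (fun s => s.2) ?_ ?_
      · rintro ⟨⟨b, c, c'⟩, p1, p2, p3, p4⟩ hs
        simp only [mem_coe, mem_sigma, mem_product, mem_filter, r, Q, f, dif] at hs ⊢
        obtain ⟨-, h1, h2, h3, h4⟩ := hs
        refine ⟨⟨h1.1, h2.1, h3.1, h4.1⟩, ?_⟩
        rw [h1.2, h2.2, h3.2, h4.2]
        abel
      · rintro ⟨⟨b, c, c'⟩, p1, p2, p3, p4⟩ hs ⟨⟨e, g, g'⟩, q1, q2, q3, q4⟩ hs' he
        simp only [Prod.mk.injEq] at he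
        obtain ⟨rfl, rfl, rfl, rfl⟩ := he
        simp only [mem_coe, mem_sigma, mem_product, mem_filter, r] at hs hs'
        obtain ⟨-, h1, h2, h3, h4⟩ := hs
        obtain ⟨-, k1, k2, k3, k4⟩ := hs'
        -- The ends `a`, `a'` are fixed, so the outer differences recover `c` and `c'`, and then
        -- `b`.
        have e1 : c = g := sub_right_injective (h1.2.symm.trans k1.2)
        have e2 : c' = g' := sub_right_injective (h4.2.symm.trans k4.2)
        subst e1 e2
        have e3 : b = e := sub_left_injective (h2.2.symm.trans k2.2)
        subst e3
        rfl
    calc _ ≤ (T.card : ℝ) * (n / (2 * κ)) ^ 4 := by gcongr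
      _ = ∑ _t ∈ T, (n / (2 * κ)) * ((n / (2 * κ)) * ((n / (2 * κ)) * (n / (2 * κ)))) := by
          rw [Finset.sum_const, nsmul_eq_mul]; ring
      _ ≤ ∑ t ∈ T, ((r (a - t.2.1)).card : ℝ) * ((r (t.1 - t.2.1)).card * ((r (t.1 - t.2.2)).card *
            (r (a' - t.2.2)).card)) := by
          refine Finset.sum_le_sum fun t ht => ?_
          obtain ⟨h1, h2, h3, h4⟩ := (Finset.mem_filter.1 ht).2
          have h0 : 0 ≤ n / (2 * κ) := by positivity
          simp only [R] at h1 h2 h3 h4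
          gcongr
      _ = ((T.sigma fun t => r (a - t.2.1) ×ˢ r (t.1 - t.2.1) ×ˢ r (t.1 - t.2.2) ×ˢ
            r (a' - t.2.2)).card : ℝ) := by
          rw [Finset.card_sigma]
          push_cast [Finset.card_product]
          rfl
      _ ≤ _ := by exact_mod_cast hsub
  have htot : ((A' - A').card : ℝ) *
      ((1 / (2 * κ)) ^ 5 * n ^ 3 / 2 ^ 10 * (n / (2 * κ)) ^ 4) ≤ n ^ 8 := by
    rw [← hQ, ← nsmul_eq_mul, ← Finset.sum_const]
    refine (Finset.sum_le_sum hfib).trans ?_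
    rw [← Nat.cast_sum]
    rw [Finset.sum_card_fiberwise_eq_card_filter]
    exact Nat.cast_le.2 (Finset.card_filter_le _ _)
  have hpos : 0 < (1 / (2 * κ)) ^ 5 * n ^ 3 / 2 ^ 10 * (n / (2 * κ)) ^ 4 := by positivity
  refine le_of_mul_le_mul_right (htot.trans (le_of_eq ?_)) hpos
  field_simp

/-! ### Thickening and growth of the odds -/

/-- Every cut of `A` into two parts has energy at least `|X|² |Y|² / (K |A|)`. -/
def HasLargeCutEnergy {G : Type*} [AddCommGroup G] [DecidableEq G] (K : ℝ) (A : Finset G) : Prop :=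
  ∀ X Y : Finset G, X ∪ Y = A → Disjoint X Y →
    (X.card : ℝ) ^ 2 * (Y.card : ℝ) ^ 2 / (K * (A.card : ℝ)) ≤ (X.addEnergy Y : ℝ)

theorem HasLargeCutEnergy.mono {G : Type*} [AddCommGroup G] [DecidableEq G] {K L : ℝ}
    {A : Finset G} (h : HasLargeCutEnergy K A) (hK : 0 < K) (hKL : K ≤ L) :
    HasLargeCutEnergy L A := by
  intro X Y hXY hd
  refine le_trans ?_ (h X Y hXY hd)
  rcases A.eq_empty_or_nonempty with rfl | hA
  · simp
  have : (0 : ℝ) < A.card := by exact_mod_cast hA.card_pos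
  gcongr

theorem card_sdiff_cast {G : Type*} [DecidableEq G] {X A : Finset G} (h : X ⊆ A) :
    ((A \ X).card : ℝ) = A.card - X.card := by
  rw [Finset.card_sdiff_of_subset h, Nat.cast_sub (Finset.card_le_card h)]

/-- Greedy covering of `A` with `τ = |A|/T`. The extra translate by `0`, which keeps `X` inside `V`,
accounts for the `+ 1`. -/
theorem exists_thickening {G : Type*} [AddCommGroup G] [DecidableEq G] {X A : Finset G}
    (hX : X ⊆ A) (hA : A.Nonempty) {T : ℝ} (hT : 0 < T) :
    ∃ V F : Finset G, X ⊆ V ∧ V ⊆ A ∧ V ⊆ X + F ∧ (F.card : ℝ) ≤ T + 1 ∧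
      (X.addEnergy (A \ V) : ℝ) ≤ A.card / T * X.card * (A \ V).card := by
  have hn : (0 : ℝ) < A.card := by exact_mod_cast hA.card_pos
  obtain ⟨S, hS, hS'⟩ := exists_card_translate_inter_sdiff_le X A (div_pos hn hT)
  refine ⟨A ∩ (X + insert 0 S), insert 0 S, ?_, Finset.inter_subset_left,
    Finset.inter_subset_right, ?_, addEnergy_le_of_card_translate_le fun s => ?_⟩
  · intro x hx
    exact Finset.mem_inter.2 ⟨hX hx,
      Finset.mem_add.2 ⟨x, hx, 0, Finset.mem_insert_self _ _, add_zero x⟩⟩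
  · have h1 : ((insert 0 S).card : ℝ) ≤ S.card + 1 := by
      exact_mod_cast Finset.card_insert_le 0 S
    have h2 : (S.card : ℝ) ≤ T := by
      rw [mul_div_assoc', div_le_iff₀ hT, mul_comm] at hS
      exact le_of_mul_le_mul_left hS hn
    linarith
  · refine le_trans (Nat.cast_le.2 (Finset.card_le_card (Finset.filter_subset_filter _ ?_))) (hS' s)
    intro a ha
    rw [Finset.mem_sdiff] at ha ⊢
    refine ⟨ha.1, fun h => ha.2 (Finset.mem_inter.2 ⟨ha.1, ?_⟩)⟩
    exact Finset.add_subset_add_left (Finset.subset_insert _ _) h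

/-- Quasi-additivity splits off `U` on one side and `A \ V` on the other. Since `|X| |A \ X| ≥
n²/(16LB)`, the factor `192 = 12 · 16` makes each discarded energy at most a twelfth of the lower
bound for the cut; with weights 2 and 4 they use half of it, leaving an eighth for `X \ U` against
`V \ X`. -/
theorem HasLargeCutEnergy.sq_mul_sq_le_cube {G : Type*} [AddCommGroup G] [DecidableEq G]
    {A U X V : Finset G} {L B : ℝ} (h : HasLargeCutEnergy L A) (hL : 0 < L) (hB : 0 < B)
    (hA : A.Nonempty) (hUX : U ⊆ X) (hXV : X ⊆ V) (hVA : V ⊆ A)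
    (hU : (U.addEnergy (A \ X) : ℝ) ≤
      A.card / (192 * L ^ 2 * B) * U.card * (A \ X).card)
    (hX : (X.addEnergy (A \ V) : ℝ) ≤
      A.card / (192 * L ^ 2 * B) * X.card * (A \ V).card)
    (hx : A.card / B ≤ (X.card : ℝ)) (hy : A.card / (16 * L) ≤ ((A \ X).card : ℝ)) :
    (X.card : ℝ) ^ 2 * ((A \ X).card : ℝ) ^ 2 / (8 * L * A.card) ≤
      ((V.card : ℝ) - U.card) ^ 3 := by
  have hXA := hXV.trans hVA
  have hn : (0 : ℝ) < A.card := by exact_mod_cast hA.card_pos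
  set n : ℝ := (A.card : ℝ) with hndef
  set x : ℝ := (X.card : ℝ) with hxdef
  set y : ℝ := ((A \ X).card : ℝ) with hydef
  have hux : (U.card : ℝ) ≤ x := Nat.cast_le.2 (Finset.card_le_card hUX)
  have hwy : ((A \ V).card : ℝ) ≤ y :=
    Nat.cast_le.2 (Finset.card_le_card (Finset.sdiff_subset_sdiff subset_rfl hXV))
  have hE := h X (A \ X) (Finset.union_sdiff_of_subset hXA) Finset.disjoint_sdiff
  rw [← hxdef, ← hydef, ← hndef] at hE
  have h1 : (X.addEnergy (A \ X) : ℝ) ≤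
      2 * U.addEnergy (A \ X) + 2 * (X \ U).addEnergy (A \ X) := by
    have := addEnergy_union_left_le U (X \ U) (A \ X)
    rw [Finset.union_sdiff_of_subset hUX] at this
    exact_mod_cast this
  have h2 : ((X \ U).addEnergy (A \ X) : ℝ) ≤
      2 * (X \ U).addEnergy (V \ X) + 2 * (X \ U).addEnergy (A \ V) := by
    have := addEnergy_union_right_le (X \ U) (V \ X) (A \ V)
    have he : V \ X ∪ A \ V = A \ X := by
      rw [Finset.union_comm]
      exact Finset.sdiff_union_sdiff_cancel hVA hXV
    rw [he] at this
    exact_mod_cast this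
  have h3 : ((X \ U).addEnergy (A \ V) : ℝ) ≤ X.addEnergy (A \ V) :=
    Nat.cast_le.2 (Finset.addEnergy_mono_left Finset.sdiff_subset)
  have hτ : n / (192 * L ^ 2 * B) * x * y ≤ x ^ 2 * y ^ 2 / (12 * L * n) := by
    have hxy : n / B * (n / (16 * L)) ≤ x * y := mul_le_mul hx hy (by positivity) (by positivity)
    have h0 : 0 ≤ x * y / (12 * L * n) := by positivity
    calc n / (192 * L ^ 2 * B) * x * y = n / B * (n / (16 * L)) * (x * y / (12 * L * n)) := by
          field_simp; ring
      _ ≤ x * y * (x * y / (12 * L * n)) := by gcongr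
      _ = _ := by ring
  have h4 : n / (192 * L ^ 2 * B) * U.card * y ≤ n / (192 * L ^ 2 * B) * x * y := by
    gcongr
  have h5 : n / (192 * L ^ 2 * B) * x * (A \ V).card ≤ n / (192 * L ^ 2 * B) * x * y := by
    gcongr
  have h6 := addEnergy_le_sq_card_mul_card (X \ U) (V \ X)
  have h7 : x ^ 2 * y ^ 2 / (8 * L * n) ≤ (X \ U).addEnergy (V \ X) := by
    have e1 : x ^ 2 * y ^ 2 / (12 * L * n) = x ^ 2 * y ^ 2 / (L * n) / 12 := by field_simp
    have e2 : x ^ 2 * y ^ 2 / (8 * L * n) = x ^ 2 * y ^ 2 / (L * n) / 8 := by field_simp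
    rw [e1] at hτ
    rw [e2]
    linarith
  refine h7.trans (h6.trans ?_)
  rw [card_sdiff_cast hUX, card_sdiff_cast hXV, ← hxdef]
  have hv : 0 ≤ (V.card : ℝ) - x := sub_nonneg.2 (Nat.cast_le.2 (Finset.card_le_card hXV))
  have hu : 0 ≤ x - U.card := sub_nonneg.2 hux
  calc (x - U.card) ^ 2 * (V.card - x) ≤ ((V.card : ℝ) - U.card) ^ 2 * (V.card - U.card) := by
        gcongr; linarith
    _ = _ := by ring

/-- The odds `v/(n - v)` are at least `1 + β` times `u/(n - u)`, in a form that allows `v = n`. The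
smaller of `x` and `n - x` decides whether `v` has grown or `n - v` has shrunk by that factor. -/
theorem one_add_mul_mul_sub_le {u x v n L β : ℝ} (hL : 0 < L) (hβ : 0 < β)
    (hβL : β ^ 3 * (16 * L) ≤ 1) (hn : 0 < n) (hu : 0 ≤ u) (hux : u ≤ x) (hxv : x ≤ v) (hvn : v ≤ n)
    (h : x ^ 2 * (n - x) ^ 2 / (8 * L * n) ≤ (v - u) ^ 3) :
    (1 + β) * u * (n - v) ≤ v * (n - u) := by
  -- Used with `m = min(x, n - x)`; the other factor is at least `n/2`.
  have key : ∀ m, 0 ≤ m → 2 * m ≤ n → m ^ 2 * n ^ 2 / 4 ≤ x ^ 2 * (n - x) ^ 2 →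
      β * m ≤ v - u := by
    intro m hm hmn hmx
    refine le_of_pow_le_pow_left₀ three_ne_zero (by linarith) (le_trans ?_ h)
    rw [le_div_iff₀ (by positivity)]
    calc (β * m) ^ 3 * (8 * L * n) = (β ^ 3 * (16 * L)) * (m ^ 3 * n / 2) := by ring
      _ ≤ 1 * (m ^ 3 * n / 2) := by gcongr
      _ = m ^ 2 * n * (2 * m) / 4 := by ring
      _ ≤ m ^ 2 * n * n / 4 := by gcongr
      _ = m ^ 2 * n ^ 2 / 4 := by ring
      _ ≤ _ := hmx
  rcases le_total (2 * x) n with hx | hx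
  · have h1 : β * x ≤ v - u := by
      refine key x (by linarith) hx ?_
      have : (n / 2) ^ 2 ≤ (n - x) ^ 2 := pow_le_pow_left₀ (by positivity) (by linarith) 2
      nlinarith [mul_le_mul_of_nonneg_left this (sq_nonneg x)]
    have h2 : (1 + β) * u ≤ v := by nlinarith
    exact mul_le_mul h2 (by linarith) (by linarith) (by linarith)
  · have h1 : β * (n - x) ≤ v - u := by
      refine key (n - x) (by linarith) (by linarith) ?_
      have : (n / 2) ^ 2 ≤ x ^ 2 := pow_le_pow_left₀ (by positivity) (by linarith) 2
      nlinarith [mul_le_mul_of_nonneg_left this (sq_nonneg (n - x))]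
    have h2 : (1 + β) * (n - v) ≤ n - u := by nlinarith
    calc (1 + β) * u * (n - v) = u * ((1 + β) * (n - v)) := by ring
      _ ≤ v * (n - u) := mul_le_mul (by linarith) h2
          (mul_nonneg (by linarith) (by linarith)) (by linarith)

/-- Iterated thickening of `X₀` reaches almost all of `A`. -/
theorem HasLargeCutEnergy.exists_almost_covering {G : Type*} [AddCommGroup G] [DecidableEq G]
    {A X₀ : Finset G} {L B β : ℝ} (h : HasLargeCutEnergy L A) (hL : 0 < L) (hB : 0 < B)
    (hβ : 0 < β) (hβL : β ^ 3 * (16 * L) ≤ 1) (hA : A.Nonempty) (hX₀ : X₀ ⊆ A)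
    (hX₀B : A.card / B ≤ (X₀.card : ℝ)) {J : ℕ} (hJ : 16 * L * B ≤ (1 + β) ^ J) :
    ∃ X F : Finset G, X₀ ⊆ X ∧ X ⊆ A ∧ X ⊆ X₀ + F ∧
      (F.card : ℝ) ≤ (192 * L ^ 2 * B + 1) ^ (2 * J) ∧
      ((A \ X).card : ℝ) ≤ A.card / (16 * L) := by
  set T : ℝ := 192 * L ^ 2 * B with hTdef
  have hT : 0 < T := by positivity
  have hn : (0 : ℝ) < A.card := by exact_mod_cast hA.card_pos
  have hstep : ∀ X : {X : Finset G // X ⊆ A}, ∃ V : {X : Finset G // X ⊆ A}, ∃ F : Finset G,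
      X.1 ⊆ V.1 ∧ V.1 ⊆ X.1 + F ∧ (F.card : ℝ) ≤ T + 1 ∧
      (X.1.addEnergy (A \ V.1) : ℝ) ≤ A.card / T * X.1.card * (A \ V.1).card := by
    rintro ⟨X, hX⟩
    obtain ⟨V, F, h1, h2, h3, h4, h5⟩ := exists_thickening hX hA hT
    exact ⟨⟨V, h2⟩, F, h1, h3, h4, h5⟩
  choose N F hN hNF hF hNE using hstep
  let X : ℕ → {X : Finset G // X ⊆ A} := fun k => N^[k] ⟨X₀, hX₀⟩
  have hXs : ∀ k, X (k + 1) = N (X k) := fun k => Function.iterate_succ_apply' _ _ _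
  have hX0 : ∀ k, X₀ ⊆ (X k).1 := by
    intro k
    induction k with
    | zero => exact subset_rfl
    | succ k ih => rw [hXs]; exact ih.trans (hN _)
  have hXF : ∀ k, ∃ D : Finset G, (X k).1 ⊆ X₀ + D ∧ (D.card : ℝ) ≤ (T + 1) ^ k := by
    intro k
    induction k with
    | zero => exact ⟨{0}, fun x hx => Finset.mem_add.2
        ⟨x, hx, 0, Finset.mem_singleton_self _, add_zero x⟩, by simp⟩
    | succ k ih =>
      obtain ⟨D, hD, hDc⟩ := ih
      refine ⟨D + F (X k), ?_, ?_⟩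
      · rw [hXs, ← add_assoc]
        exact (hNF _).trans (Finset.add_subset_add_right hD)
      · calc ((D + F (X k)).card : ℝ) ≤ D.card * (F (X k)).card := by
              exact_mod_cast Finset.card_add_le
          _ ≤ (T + 1) ^ k * (T + 1) := by
              gcongr
              exact hF _
          _ = _ := (pow_succ _ _).symm
  suffices hk : ∃ k ≤ 2 * J, ((A \ (X k).1).card : ℝ) ≤ A.card / (16 * L) by
    obtain ⟨k, hk, hkc⟩ := hk
    obtain ⟨D, hD, hDc⟩ := hXF k
    exact ⟨(X k).1, D, hX0 k, (X k).2, hD,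
      hDc.trans (pow_le_pow_right₀ (by linarith) hk), hkc⟩
  by_contra! hcon
  have hX0pos : (0 : ℝ) < X₀.card := lt_of_lt_of_le (by positivity) hX₀B
  -- Only even indices occur because the growth estimate compares sets two thickenings apart.
  have hgrow : ∀ j ≤ J, (1 + β) ^ j * X₀.card * (A.card - (X (2 * j)).1.card) ≤
      (X (2 * j)).1.card * A.card := by
    intro j
    induction j with
    | zero =>
      intro _
      have : (0 : ℝ) ≤ X₀.card := Nat.cast_nonneg _
      simp only [X, mul_zero, Function.iterate_zero, id, pow_zero, one_mul]
      nlinarith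
    | succ j ih =>
      intro hj
      have ih := ih (by omega)
      have e : X (2 * (j + 1)) = N (N (X (2 * j))) := by
        rw [show 2 * (j + 1) = 2 * j + 1 + 1 by ring, hXs, hXs]
      have h1 := h.sq_mul_sq_le_cube hL hB hA (hN (X (2 * j))) (hN (N (X (2 * j)))) (N _).2
        (hNE _) (hNE _)
        (hX₀B.trans (Nat.cast_le.2 (Finset.card_le_card ((hX0 _).trans (hN _)))))
        (by rw [← hXs]; exact (hcon (2 * j + 1) (by omega)).le)
      rw [card_sdiff_cast (N _).2] at h1
      have h2 := one_add_mul_mul_sub_le hL hβ hβL hn (Nat.cast_nonneg _)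
        (Nat.cast_le.2 (Finset.card_le_card (hN (X (2 * j)))))
        (Nat.cast_le.2 (Finset.card_le_card (hN (N (X (2 * j))))))
        (Nat.cast_le.2 (Finset.card_le_card (N (N (X (2 * j)))).2)) h1
      rw [e]
      set u : ℝ := ((X (2 * j)).1.card : ℝ)
      set v : ℝ := ((N (N (X (2 * j)))).1.card : ℝ)
      have hu : 0 < u := hX0pos.trans_le (Nat.cast_le.2 (Finset.card_le_card (hX0 _)))
      refine le_of_mul_le_mul_left ?_ hu
      have hP : 0 ≤ (1 + β) ^ j * X₀.card := by positivity
      have hv : 0 ≤ v := Nat.cast_nonneg _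
      calc u * ((1 + β) ^ (j + 1) * X₀.card * (A.card - v))
          = (1 + β) ^ j * X₀.card * ((1 + β) * u * (A.card - v)) := by ring
        _ ≤ (1 + β) ^ j * X₀.card * (v * (A.card - u)) := by gcongr
        _ = v * ((1 + β) ^ j * X₀.card * (A.card - u)) := by ring
        _ ≤ v * (u * A.card) := by gcongr
        _ = _ := by ring
  have h1 := hgrow J le_rfl
  have h2 := hcon (2 * J) le_rfl
  rw [card_sdiff_cast (X _).2] at h2
  have h3 : ((X (2 * J)).1.card : ℝ) ≤ A.card := Nat.cast_le.2 (Finset.card_le_card (X _).2)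
  set n : ℝ := (A.card : ℝ)
  -- Odds growing from `1/B` past `16L` would make the set larger than `A`.
  have h4 : n * n < (1 + β) ^ J * X₀.card * (n - (X (2 * J)).1.card) :=
    calc n * n = (16 * L * B) * (n / B) * (n / (16 * L)) := by field_simp
      _ ≤ (1 + β) ^ J * X₀.card * (n / (16 * L)) := by gcongr
      _ < _ := by gcongr
  nlinarith

/-! ### Covering the remainder and bounding the sumset -/

/-- Once all but a small part of `A` is exhausted by `X`, the whole of `A` is covered by few
translates of `X - X`. -/
theorem HasLargeCutEnergy.exists_covering {G : Type*} [AddCommGroup G] [DecidableEq G]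
    {A X : Finset G} {L : ℝ} (h : HasLargeCutEnergy L A) (hL : 2 ≤ L) (hX : X.Nonempty)
    (hXA : X ⊆ A) (hY : ((A \ X).card : ℝ) ≤ A.card / (16 * L)) :
    ∃ I : Finset G, (I.card : ℝ) ≤ 4 * L + 1 ∧ A ⊆ I + (X - X) := by
  classical
  have hn : (0 : ℝ) < A.card := by exact_mod_cast (hX.mono hXA).card_pos
  -- Separation: the translates `X + y` with `y ∈ I` are pairwise disjoint.
  let P : Finset G → Prop := fun I => ∀ y ∈ I, ∀ z ∈ I, y - z ∈ X - X → y = z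
  obtain ⟨I, hI, hmax⟩ := ((A \ X).powerset.filter P).exists_max_image Finset.card
    ⟨∅, Finset.mem_filter.2 ⟨Finset.empty_mem_powerset _, by simp [P]⟩⟩
  obtain ⟨hIY, hIP⟩ := Finset.mem_filter.1 hI
  rw [Finset.mem_powerset] at hIY
  obtain ⟨x₀, hx₀⟩ := hX
  refine ⟨insert x₀ I, ?_, ?_⟩
  · have hIA : I ⊆ A := hIY.trans Finset.sdiff_subset
    have h1 := h (A \ I) I (Finset.sdiff_union_of_subset hIA) Finset.sdiff_disjoint
    have h2 : ((A \ I).addEnergy I : ℝ) ≤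
        2 * X.addEnergy I + 2 * ((A \ X) \ I).addEnergy I := by
      have := addEnergy_union_left_le X ((A \ X) \ I) I
      have he : A \ I ⊆ X ∪ (A \ X) \ I := by
        intro a ha
        simp only [Finset.mem_union, Finset.mem_sdiff] at ha ⊢
        tauto
      exact_mod_cast (Finset.addEnergy_mono_left he).trans this
    have h3 : (((A \ X) \ I).addEnergy I : ℝ) ≤ A.card / (16 * L) * (I.card : ℝ) ^ 2 := by
      refine (addEnergy_le_card_mul_sq_card _ _).trans ?_
      gcongr
      exact le_trans (Nat.cast_le.2 (Finset.card_le_card Finset.sdiff_subset)) hY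
    -- By separation only trivial quadruples contribute.
    have h4 : (X.addEnergy I : ℝ) ≤ A.card * I.card := by
      have : X.addEnergy I ≤ (X ×ˢ I).card := by
        rw [Finset.addEnergy]
        refine Finset.card_le_card_of_injOn (fun q => (q.1.1, q.2.1)) ?_ ?_
        · rintro ⟨⟨x, x'⟩, y, y'⟩ hq
          simp only [Finset.mem_coe, Finset.mem_filter, Finset.mem_product] at hq ⊢
          exact ⟨hq.1.1.1, hq.1.2.1⟩
        · have aux : ∀ x x' y y', ((x, x'), (y, y')) ∈ (((X ×ˢ X) ×ˢ I ×ˢ I).filter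
              fun q => q.1.1 + q.2.1 = q.1.2 + q.2.2) → x = x' ∧ y = y' := by
            intro x x' y y' hq
            simp only [Finset.mem_filter, Finset.mem_product] at hq
            obtain ⟨⟨⟨hx, hx'⟩, hy, hy'⟩, he⟩ := hq
            have hyy : y = y' := by
              refine hIP y hy y' hy' (Finset.mem_sub.2 ⟨x', hx', x, hx, ?_⟩)
              rw [sub_eq_sub_iff_add_eq_add, ← he, add_comm]
            subst hyy
            exact ⟨by simpa using he, rfl⟩
          rintro ⟨⟨x, x'⟩, y, y'⟩ hq ⟨⟨z, z'⟩, w, w'⟩ hq' he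
          obtain ⟨rfl, rfl⟩ := aux _ _ _ _ hq
          obtain ⟨rfl, rfl⟩ := aux _ _ _ _ hq'
          simp only [Prod.mk.injEq] at he
          obtain ⟨rfl, rfl⟩ := he
          rfl
      rw [Finset.card_product] at this
      refine (Nat.cast_le.2 this).trans ?_
      push_cast
      gcongr
    have h5 : (I.card : ℝ) ≤ A.card / 32 := by
      refine (Nat.cast_le.2 (Finset.card_le_card hIY)).trans (hY.trans ?_)
      gcongr
      linarith
    have hIc : (I.card : ℝ) ≤ 4 * L := by
      rw [card_sdiff_cast hIA] at h1
      set n : ℝ := (A.card : ℝ)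
      rcases (Nat.cast_nonneg (α := ℝ) I.card).eq_or_lt with h0 | h0
      · rw [← h0]; linarith
      set i : ℝ := (I.card : ℝ)
      have h6 : (31 / 32 * n) ^ 2 ≤ (n - i) ^ 2 :=
        pow_le_pow_left₀ (by positivity) (by linarith) 2
      -- The cut at `I` has energy of order at least `n |I|²/L`, while `X` contributes only `n |I|`;
      -- hence `|I| = O(L)`.
      have h7 : (31 / 32 * n) ^ 2 * i ^ 2 / (L * n) ≤ 2 * (n * i) + 2 * (n / (16 * L) * i ^ 2) := by
        refine le_trans ?_ (h1.trans (h2.trans (by linarith)))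
        gcongr
      have e1 : (31 / 32 * n) ^ 2 * i ^ 2 / (L * n) = (n * i / L) * ((31 / 32) ^ 2 * i) := by
        field_simp
      have e2 : 2 * (n * i) + 2 * (n / (16 * L) * i ^ 2) = (n * i / L) * (2 * L + i / 8) := by
        field_simp; ring
      rw [e1, e2] at h7
      have h8 := le_of_mul_le_mul_left h7 (by positivity)
      linarith
    have : ((insert x₀ I).card : ℝ) ≤ I.card + 1 := by exact_mod_cast Finset.card_insert_le x₀ I
    linarith
  · have hcov : ∀ a y, y ∈ insert x₀ I → a - y ∈ X - X → a ∈ insert x₀ I + (X - X) :=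
      fun a y hy hay => Finset.mem_add.2 ⟨y, hy, a - y, hay, add_sub_cancel _ _⟩
    have hsymm : ∀ g, g ∈ X - X → -g ∈ X - X := by
      intro g hg
      obtain ⟨b, hb, c, hc, rfl⟩ := Finset.mem_sub.1 hg
      rw [neg_sub]
      exact Finset.sub_mem_sub hc hb
    have hzero : (0 : G) ∈ X - X := Finset.mem_sub.2 ⟨x₀, hx₀, x₀, hx₀, sub_self _⟩
    intro a ha
    by_cases haX : a ∈ X
    · exact hcov a x₀ (Finset.mem_insert_self _ _) (Finset.sub_mem_sub haX hx₀)
    by_cases haI : a ∈ I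
    · exact hcov a a (Finset.mem_insert_of_mem haI) (by rwa [sub_self])
    by_contra hna
    have hfar : ∀ y ∈ I, a - y ∉ X - X := fun y hy hay =>
      hna (hcov a y (Finset.mem_insert_of_mem hy) hay)
    have hins : insert a I ∈ (A \ X).powerset.filter P := by
      refine Finset.mem_filter.2 ⟨Finset.mem_powerset.2 (Finset.insert_subset
        (Finset.mem_sdiff.2 ⟨ha, haX⟩) hIY), ?_⟩
      intro y hy z hz hyz
      rcases Finset.mem_insert.1 hy with rfl | hy' <;> rcases Finset.mem_insert.1 hz with rfl | hz'
      · rfl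
      · exact absurd hyz (hfar z hz')
      · exact absurd (by simpa using hsymm _ hyz) (hfar y hy')
      · exact hIP y hy' z hz' hyz
    have := hmax _ hins
    rw [Finset.card_insert_of_notMem haI] at this
    omega

theorem card_add_self_le_of_subset {G : Type*} [AddCommGroup G] [DecidableEq G]
    {A I X X₀ F : Finset G} (hA : A ⊆ I + (X - X)) (hX : X ⊆ X₀ + F) :
    (A + A).card ≤ I.card ^ 2 * F.card ^ 4 * (2 • X₀ - 2 • X₀).card := by
  have h1 : A ⊆ I + ((X₀ + F) - (X₀ + F)) :=
    hA.trans (Finset.add_subset_add_left (Finset.sub_subset_sub hX hX))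
  have h2 : A + A ⊆ ((I + I) + ((F + F) - (F + F))) + (2 • X₀ - 2 • X₀) := by
    refine (Finset.add_subset_add h1 h1).trans (Eq.subset ?_)
    simp only [sub_eq_add_neg, two_nsmul, neg_add]
    ac_rfl
  calc _ ≤ _ := Finset.card_le_card h2
    _ ≤ (I + I).card * ((F + F).card * (F + F).card) * (2 • X₀ - 2 • X₀).card := by
        refine Finset.card_add_le.trans (Nat.mul_le_mul_right _ (Finset.card_add_le.trans ?_))
        exact Nat.mul_le_mul_left _ Finset.card_sub_le
    _ ≤ (I.card * I.card) * ((F.card * F.card) * (F.card * F.card)) * (2 • X₀ - 2 • X₀).card := by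
        gcongr <;> exact Finset.card_add_le
    _ = _ := by ring

/-- From a cut into halves: `⌊n/2⌋ ≥ n/3` gives `|X| |A \ X| ≥ 2n²/9`, and `(2/9)² ≥ 1/21`. -/
theorem HasLargeCutEnergy.le_addEnergy_self {G : Type*} [AddCommGroup G] [DecidableEq G]
    {A : Finset G} {L : ℝ} (h : HasLargeCutEnergy L A) (hL : 0 < L) (hA : 2 ≤ A.card) :
    (A.card : ℝ) ^ 3 / (21 * L) ≤ A.addEnergy A := by
  obtain ⟨X, hXA, hX⟩ := Finset.exists_subset_card_eq (Nat.div_le_self A.card 2)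
  have h1 := h X (A \ X) (Finset.union_sdiff_of_subset hXA) Finset.disjoint_sdiff
  have h2 : (X.addEnergy (A \ X) : ℝ) ≤ A.addEnergy A :=
    Nat.cast_le.2 (Finset.addEnergy_mono hXA Finset.sdiff_subset)
  refine le_trans ?_ (h1.trans h2)
  rw [card_sdiff_cast hXA]
  have h3 : (A.card : ℝ) ≤ 3 * X.card := by exact_mod_cast (by omega : A.card ≤ 3 * X.card)
  have h4 : 2 * (X.card : ℝ) ≤ A.card := by exact_mod_cast (by omega : 2 * X.card ≤ A.card)
  have hn : (0 : ℝ) < A.card := by exact_mod_cast (by omega : 0 < A.card)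
  set n : ℝ := (A.card : ℝ)
  set x : ℝ := (X.card : ℝ)
  have h5 : n ^ 2 * (2 / 9) ≤ x * (n - x) := by nlinarith
  have h6 : (n ^ 2 * (2 / 9)) ^ 2 ≤ (x * (n - x)) ^ 2 := pow_le_pow_left₀ (by positivity) h5 2
  rw [← mul_pow, div_le_div_iff₀ (by positivity) (by positivity)]
  have h7 : n ^ 4 ≤ 21 * (x * (n - x)) ^ 2 := by nlinarith [pow_pos hn 4]
  calc n ^ 3 * (L * n) = L * n ^ 4 := by ring
    _ ≤ L * (21 * (x * (n - x)) ^ 2) := by gcongr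
    _ = _ := by ring

/-- Polynomial form of the doubling estimate, in terms of the number `J` of thickening steps. -/
theorem HasLargeCutEnergy.doublingConstant_le_of_pow {G : Type*} [AddCommGroup G] [DecidableEq G]
    {A : Finset G} {L β : ℝ} (h : HasLargeCutEnergy L A) (hL : 2 ≤ L) (hA : 2 ≤ A.card)
    (hβ : 0 < β) (hβL : β ^ 3 * (16 * L) ≤ 1) {J : ℕ} (hJ : 16 * L * (168 * L) ≤ (1 + β) ^ J) :
    doublingConstant A ≤ (4 * L + 1) ^ 2 * (192 * L ^ 2 * (168 * L) + 1) ^ (8 * J) *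
      (2 ^ 22 * (21 * L) ^ 10) ^ 4 := by
  have hL0 : 0 < L := by linarith
  have hAne : A.Nonempty := Finset.card_pos.1 (by omega)
  have hn : (0 : ℝ) < A.card := by exact_mod_cast hAne.card_pos
  obtain ⟨X₀, hX₀A, hX₀c, hX₀d⟩ := exists_subset_card_sub_le_of_addEnergy hAne
    (by positivity : 0 < 21 * L) (h.le_addEnergy_self hL0 hA)
  have hX₀pos : (0 : ℝ) < X₀.card := lt_of_lt_of_le (by positivity) hX₀c
  have hX₀ne : X₀.Nonempty := Finset.card_pos.1 (by exact_mod_cast hX₀pos)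
  rw [show 8 * (21 * L) = 168 * L by ring] at hX₀c
  obtain ⟨X, F, hX₀X, hXA, hXF, hF, hX⟩ := h.exists_almost_covering hL0
    (by positivity : 0 < 168 * L) hβ hβL hAne hX₀A hX₀c hJ
  obtain ⟨I, hI, hAI⟩ := h.exists_covering hL (hX₀ne.mono hX₀X) hXA hX
  have h1 : ((A + A).card : ℝ) ≤
      (I.card : ℝ) ^ 2 * (F.card : ℝ) ^ 4 * (2 • X₀ - 2 • X₀).card := by
    exact_mod_cast card_add_self_le_of_subset hAI hXF
  have h2 : ((2 • X₀ - 2 • X₀).card : ℝ) ≤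
      (((X₀ - X₀).card : ℝ) / X₀.card) ^ 4 * X₀.card := by
    have := Finset.pluennecke_ruzsa_inequality_nsmul_sub_nsmul_sub hX₀ne X₀ 2 2
    have h := (NNRat.cast_le (K := ℝ)).2 this
    push_cast at h
    exact h
  -- Measuring against `|X₀|` rather than `|A|` costs `168L = 8 · 21L`, hence the exponents 22 and
  -- 10.
  have h3 : ((X₀ - X₀).card : ℝ) / X₀.card ≤ 2 ^ 22 * (21 * L) ^ 10 := by
    rw [div_le_iff₀ hX₀pos]
    calc _ ≤ _ := hX₀d
      _ = 2 ^ 22 * (21 * L) ^ 10 * (A.card / (168 * L)) := by field_simp; ring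
      _ ≤ _ := by gcongr
  have h4 : (X₀.card : ℝ) ≤ A.card := Nat.cast_le.2 (Finset.card_le_card hX₀A)
  rw [doublingConstant, div_le_iff₀ hn]
  calc ((A + A).card : ℝ) ≤ _ := h1
    _ ≤ (4 * L + 1) ^ 2 * ((192 * L ^ 2 * (168 * L) + 1) ^ (2 * J)) ^ 4 *
        ((2 ^ 22 * (21 * L) ^ 10) ^ 4 * A.card) := by
        gcongr
        exact h2.trans (by gcongr)
    _ = _ := by
        rw [← pow_mul]
        ring

/-! ### Choice of parameters and the final bounds -/

theorem HasLargeCutEnergy.doublingConstant_le_exp {G : Type*} [AddCommGroup G] [DecidableEq G]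
    {A : Finset G} {L : ℝ} (h : HasLargeCutEnergy L A) (hL : 2 ≤ L) (hA : 2 ≤ A.card) :
    doublingConstant A ≤ Real.exp (25000 * (L ^ (1 / 3 : ℝ) * Real.log L ^ 2)) := by
  have hL0 : 0 < L := by linarith
  set w : ℝ := L ^ (1 / 3 : ℝ) with hw
  set l : ℝ := Real.log L with hl
  have hw3 : w ^ 3 = L := by
    rw [hw, ← Real.rpow_natCast, ← Real.rpow_mul hL0.le]
    norm_num
  have hw1 : 1 ≤ w := Real.one_le_rpow (by linarith) (by norm_num)
  have hl2 : 1 / 2 ≤ l := by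
    have h1 := Real.log_two_gt_d9
    have h2 := Real.log_le_log two_pos hL
    linarith
  have hpow : ∀ k : ℕ, L ^ k = Real.exp (k * l) := fun k => by
    rw [Real.exp_nat_mul, hl, Real.exp_log hL0]
  have h2pow : ∀ k : ℕ, (2 : ℝ) ^ k ≤ L ^ k := fun k => pow_le_pow_left₀ two_pos.le hL k
  have hLpow : ∀ k : ℕ, 0 < L ^ k := fun k => pow_pos hL0 k
  set β : ℝ := (3 * w)⁻¹ with hβ
  have hβ0 : 0 < β := by positivity
  have hβ1 : β ≤ 1 := inv_le_one_of_one_le₀ (by linarith)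
  have hβL : β ^ 3 * (16 * L) ≤ 1 := by
    rw [hβ, inv_pow, mul_pow, hw3, inv_mul_le_iff₀ (by positivity)]
    linarith
  have hexp : Real.exp (β / 2) ≤ 1 + β := by
    rw [← Real.le_log_iff_exp_le (by linarith)]
    refine le_trans ?_ (Real.le_log_one_add_of_nonneg hβ0.le)
    rw [div_le_div_iff₀ two_pos (by linarith)]
    nlinarith
  -- Chosen so that `J β/2 ≥ 14 log L`, as `16 · 168 L² ≤ L¹⁴`. Since `L ≥ 2`, numerical constants
  -- are absorbed into powers of `L`.
  set J : ℕ := ⌈84 * w * l⌉₊ with hJdef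
  have hJle : (J : ℝ) ≤ 84 * w * l + 1 := (Nat.ceil_lt_add_one (by positivity)).le
  have hJ : 16 * L * (168 * L) ≤ (1 + β) ^ J := by
    calc 16 * L * (168 * L) ≤ 2 ^ 12 * L ^ 2 := by nlinarith [hLpow 2]
      _ ≤ L ^ 12 * L ^ 2 := by gcongr
      _ = Real.exp ((14 : ℕ) * l) := by rw [← hpow]; ring
      _ ≤ Real.exp (J * (β / 2)) := by
          refine Real.exp_le_exp.2 ?_
          have : 84 * w * l * (β / 2) ≤ J * (β / 2) :=
            mul_le_mul_of_nonneg_right (Nat.le_ceil _) (by positivity)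
          refine le_trans (le_of_eq ?_) this
          rw [hβ]
          field_simp
          norm_num
      _ = Real.exp (β / 2) ^ J := Real.exp_nat_mul _ _
      _ ≤ _ := by gcongr
  refine (h.doublingConstant_le_of_pow hL hA hβ0 hβL hJ).trans ?_
  have b1 : 4 * L + 1 ≤ L ^ 4 := by
    have : 2 ^ 3 * L ≤ L ^ 3 * L := by gcongr
    nlinarith
  have b2 : 192 * L ^ 2 * (168 * L) + 1 ≤ L ^ 19 := by
    have h1 : 2 ^ 16 * L ^ 3 ≤ L ^ 16 * L ^ 3 := by gcongr
    have h2 := h2pow 3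
    calc _ ≤ 2 ^ 16 * L ^ 3 := by linarith
      _ ≤ _ := h1
      _ = _ := by ring
  have b3 : 2 ^ 22 * (21 * L) ^ 10 ≤ L ^ 82 := by
    calc 2 ^ 22 * (21 * L) ^ 10 ≤ L ^ 22 * (2 ^ 5 * L) ^ 10 := by
          gcongr
          norm_num
      _ ≤ L ^ 22 * (L ^ 5 * L) ^ 10 := by gcongr
      _ = _ := by ring
  calc _ ≤ (L ^ 4) ^ 2 * (L ^ 19) ^ (8 * J) * (L ^ 82) ^ 4 := by gcongr
    _ = L ^ (336 + 152 * J) := by ring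
    _ = Real.exp ((336 + 152 * J) * l) := by rw [hpow]; push_cast; rfl
    _ ≤ _ := by
        refine Real.exp_le_exp.2 ?_
        have hwl : 1 ≤ 2 * (w * l) := by nlinarith
        have hfac : (336 + 152 * (J : ℝ)) ≤ 25000 * (w * l) := by nlinarith
        calc _ ≤ 25000 * (w * l) * l := by gcongr
          _ = _ := by ring

/-- Cutting off one point gives `K ≥ (n - 1)/n`. This lets the final bound carry `K^(1/3)` instead
of `(max K 2)^(1/3)`. -/
theorem HasLargeCutEnergy.half_le {G : Type*} [AddCommGroup G] [DecidableEq G]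
    {A : Finset G} {K : ℝ} (h : HasLargeCutEnergy K A) (hK : 0 < K) (hA : 2 ≤ A.card) :
    1 / 2 ≤ K := by
  obtain ⟨a, ha⟩ := Finset.card_pos.1 (show 0 < A.card by omega)
  have haA := Finset.singleton_subset_iff.2 ha
  have h1 := (h {a} (A \ {a}) (Finset.union_sdiff_of_subset haA) Finset.disjoint_sdiff).trans
    (addEnergy_le_sq_card_mul_card _ _)
  rw [card_sdiff_cast haA, Finset.card_singleton] at h1
  have hn : (2 : ℝ) ≤ A.card := by exact_mod_cast hA
  push_cast at h1
  set n : ℝ := (A.card : ℝ)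
  rw [div_le_iff₀ (by positivity)] at h1
  have h2 : (n - 1) * (n - 1) ≤ (n - 1) * (K * n) := by linarith
  have h3 := le_of_mul_le_mul_left h2 (by linarith)
  by_contra! h4
  nlinarith

theorem doublingConstant_eq_one_of_card_eq_one {G : Type*} [AddCommGroup G] [DecidableEq G]
    {A : Finset G} (hA : A.card = 1) : doublingConstant A = 1 := by
  obtain ⟨a, rfl⟩ := Finset.card_eq_one.1 hA
  simp [doublingConstant]

theorem HasLargeCutEnergy.doublingConstant_le {G : Type*} [AddCommGroup G] [DecidableEq G]
    {A : Finset G} {K : ℝ} (h : HasLargeCutEnergy K A) (hK : 0 < K) (hA : 2 ≤ A.card) :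
    doublingConstant A ≤
      Real.exp (50000 * (K ^ (1 / 3 : ℝ) * Real.log (max K 2) ^ 2)) := by
  have hK2 := h.half_le hK hA
  refine ((h.mono hK (le_max_left K 2)).doublingConstant_le_exp (le_max_right K 2) hA).trans ?_
  refine Real.exp_le_exp.2 ?_
  have h1 : (max K 2) ^ (1 / 3 : ℝ) ≤ 2 * K ^ (1 / 3 : ℝ) := by
    calc (max K 2) ^ (1 / 3 : ℝ) ≤ (8 * K) ^ (1 / 3 : ℝ) :=
          Real.rpow_le_rpow (le_max_of_le_right two_pos.le) (max_le (by linarith) (by linarith))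
            (by norm_num)
      _ = _ := by
          rw [Real.mul_rpow (by norm_num) hK.le, show (8 : ℝ) = 2 ^ (3 : ℝ) by norm_num,
            ← Real.rpow_mul two_pos.le]
          norm_num
  calc _ ≤ 25000 * (2 * K ^ (1 / 3 : ℝ) * Real.log (max K 2) ^ 2) := by gcongr
    _ = _ := by ring

theorem energyStar_nonneg {G : Type*} [AddCommGroup G] [DecidableEq G] (A : Finset G) :
    0 ≤ energyStar A := by
  refine le_trans ?_ (Finset.le_sup' _ (Finset.empty_mem_powerset A))
  positivity

theorem energyStar_pos {G : Type*} [AddCommGroup G] [DecidableEq G] {A : Finset G}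
    (hA : 2 ≤ A.card) : 0 < energyStar A := by
  obtain ⟨a, ha⟩ := Finset.card_pos.1 (show 0 < A.card by omega)
  have haA := Finset.singleton_subset_iff.2 ha
  refine lt_of_lt_of_le ?_ (Finset.le_sup' _ (Finset.mem_powerset.2 haA))
  have h1 : (A \ {a}).Nonempty := by
    rw [← Finset.card_pos, Finset.card_sdiff_of_subset haA, Finset.card_singleton]
    omega
  have h2 : (0 : ℝ) < ({a} : Finset G).addEnergy (A \ {a}) := by
    exact_mod_cast Finset.addEnergy_pos (Finset.singleton_nonempty a) h1
  have h3 : (0 : ℝ) < (A \ {a}).card := by exact_mod_cast h1.card_pos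
  have h4 : (0 : ℝ) < A.card := by exact_mod_cast (show 0 < A.card by omega)
  have h5 : (0 : ℝ) < ({a} : Finset G).card := by simp
  positivity

theorem hasLargeCutEnergy_energyStar {G : Type*} [AddCommGroup G] [DecidableEq G] {A : Finset G}
    (hA : 2 ≤ A.card) : HasLargeCutEnergy (energyStar A) A := by
  rintro X Y rfl hd
  have hM := energyStar_pos hA
  have hn : (0 : ℝ) < (X ∪ Y).card := by exact_mod_cast (show 0 < (X ∪ Y).card by omega)
  rcases X.eq_empty_or_nonempty with rfl | hX
  · simp
  rcases Y.eq_empty_or_nonempty with rfl | hY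
  · simp
  have hE : (0 : ℝ) < X.addEnergy Y := by exact_mod_cast Finset.addEnergy_pos hX hY
  have h1 : (X.card : ℝ) ^ 2 * (Y.card : ℝ) ^ 2 / ((X ∪ Y).card * X.addEnergy Y) ≤
      energyStar (X ∪ Y) := by
    have := Finset.le_sup' (fun Z => ((Z.card : ℝ) ^ 2 * (((X ∪ Y) \ Z).card : ℝ) ^ 2) /
      (((X ∪ Y).card : ℝ) * (Z.addEnergy ((X ∪ Y) \ Z) : ℝ)))
      (Finset.mem_powerset.2 (Finset.subset_union_left (s₁ := X) (s₂ := Y)))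
    simp only [Finset.union_sdiff_cancel_left hd] at this
    exact this
  rw [div_le_iff₀ (by positivity)] at h1 ⊢
  linarith

theorem theorem3p3 :
    ∃ C : ℝ, 0 < C ∧
      ∀ (G : Type*) [AddCommGroup G] [DecidableEq G] (A : Finset G), A.Nonempty →
        (doublingConstant A ≤
          Real.exp (C * (energyStar A ^ (1 / 3 : ℝ) * Real.log (max (energyStar A) 2) ^ 2))) ∧
        (∀ K : ℝ, 0 < K →
          (∀ X Y : Finset G, X ∪ Y = A → Disjoint X Y →
            (X.card : ℝ) ^ 2 * (Y.card : ℝ) ^ 2 / (K * (A.card : ℝ)) ≤ (X.addEnergy Y : ℝ)) →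
          doublingConstant A ≤
            Real.exp (C * (K ^ (1 / 3 : ℝ) * Real.log (max K 2) ^ 2))) := by
  refine ⟨50000, by norm_num, fun G _ _ A hA => ?_⟩
  -- A singleton is separate: all its cuts are trivial, so `K` may be arbitrarily small, but its
  -- doubling is 1.
  rcases (Nat.succ_le_of_lt hA.card_pos).eq_or_lt with h1 | h2
  · rw [doublingConstant_eq_one_of_card_eq_one h1.symm]
    have hM := energyStar_nonneg A
    exact ⟨Real.one_le_exp (by positivity), fun K hK _ => Real.one_le_exp (by positivity)⟩
  · exact ⟨(hasLargeCutEnergy_energyStar h2).doublingConstant_le (energyStar_pos h2) h2,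
      fun K hK h => HasLargeCutEnergy.doublingConstant_le h hK h2⟩
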